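/- Let $m\ge 1$, let $\lambda_1,\dots,\lambda_{m-1}\in\mathbb C$ and $R_1,\dots,R_{m-1}>0$, and suppose that the set $$S=\{z\in\mathbb C:\ |z|\le 1,\ |z-\lambda_j|\ge R_j,\ j=1,\dots,m-1\}$$ is nonempty. Let $p(z,\bar z)=\sum_{k,l}p_{kl}z^k\bar z^l$ be a polynomial with complex coefficients, and for an element $a$ of a unital $C^*$-algebra put $p(a,a^*)=\sum_{k,l}p_{kl}a^k(a^*)^l$. Then for every $\varepsilon>0$ there is a constant $C(p,\varepsilon)$, which may depend on $p$, $\varepsilon$, the $\lambda_j$ and the $R_j$, but not on the algebra, on $a$ or on $\delta$, such that $$\|p(a,a^*)\|\le \max_{z\in S}|p(z,\bar z)|+\varepsilon+C(p,\varepsilon)\,\delta$$ for every unital $C^*$-algebra $\mathcal A$, every real $\delta$ and every $a\in\mathcal A$ such that $\|a\|\le 1$, $\|aa^*-a^*a\|\le\delta$, and $a-\lambda_j$ is invertible with $\|(a-\lambda_j)^{-1}\|\le R_j^{-1}$ for $j=1,\dots,m-1$. -/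

import Mathlib

universe u

/-- The scalar value `p(z, z̄) = ∑ p_{kl} z^k z̄^l` of a polynomial in two variables: the variable
`0` stands for `z` and the variable `1` for `z̄`. -/
noncomputable def scalarEval (p : MvPolynomial (Fin 2) ℂ) (z : ℂ) : ℂ :=
  MvPolynomial.eval ![z, star z] p

/-- The ordered polynomial calculus `p(a, a*) = ∑ p_{kl} a^k (a*)^l`: in every monomial the powers
of `a` stand to the left of those of `a*`. -/
noncomputable def starEval {A : Type u} [CStarAlgebra A] (p : MvPolynomial (Fin 2) ℂ) (a : A) : A :=
  ∑ d ∈ p.support, p.coeff d • (a ^ d 0 * star a ^ d 1)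

/-- The closed unit disk with the open disks `|z - c j| < R j` removed. -/
def holedDisk {n : ℕ} (c : Fin n → ℂ) (R : Fin n → ℝ) : Set ℂ :=
  {z | ‖z‖ ≤ 1 ∧ ∀ j, R j ≤ ‖z - c j‖}

/-- `b` is invertible and its inverse has norm at most `r`. -/
def InvNormLE {A : Type u} [CStarAlgebra A] (b : A) (r : ℝ) : Prop :=
  ∃ v : Aˣ, (v : A) = b ∧ ‖((v⁻¹ : Aˣ) : A)‖ ≤ r

/-! The proof is by compactness and gives no explicit constant. If no `δ₀ > 0` forced `‖p(a,a*)‖ ≤ M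
+ ε`, there would be counterexamples `a_k` with commutators of norm at most `1/(k+1)`. Their class
in a C⋆-ultraproduct is exactly normal and keeps the bounds on the norm and the inverses, so its
spectrum lies in `S` and the continuous functional calculus gives `‖p(a,a*)‖ ≤ M`, a contradiction.
Once `δ > δ₀`, the crude bound `∑ |p_kl|` is absorbed by the term `C δ`. -/

open Filter Topology UniformSpace

/-! ### Completion with respect to a C⋆-seminorm -/

section Completion

namespace UniformSpace.Completion

variable {B : Type u} [SeminormedRing B]

noncomputable instance [StarRing B] : Star (Completion B) := ⟨Completion.map star⟩

section Star

variable [StarRing B] [NormedStarGroup B]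

theorem star_coe (x : B) : star (x : Completion B) = (star x : B) :=
  Completion.map_coe star_isometry.uniformContinuous x

instance : ContinuousStar (Completion B) := ⟨Completion.continuous_map⟩

noncomputable instance : StarRing (Completion B) where
  star_involutive x := by
    induction x using Completion.induction_on with
    | hp => exact isClosed_eq (by fun_prop) (by fun_prop)
    | ih x => rw [star_coe, star_coe, star_star]
  star_mul x y := by
    induction x, y using Completion.induction_on₂ with
    | hp => exact isClosed_eq (by fun_prop) (by fun_prop)
    | ih x y => rw [← coe_mul, star_coe, star_coe, star_coe, ← coe_mul, star_mul]
  star_add x y := by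
    induction x, y using Completion.induction_on₂ with
    | hp => exact isClosed_eq (by fun_prop) (by fun_prop)
    | ih x y => rw [← coe_add, star_coe, star_coe, star_coe, ← coe_add, star_add]

end Star

variable [NormedAlgebra ℂ B]

noncomputable instance complexNormedAlgebra : NormedAlgebra ℂ (Completion B) where
  __ := Algebra.ofModule (R := ℂ) (A := Completion B)
    (fun r x y ↦ by
      induction x, y using Completion.induction_on₂ with
      | hp =>
        exact isClosed_eq ((continuous_fst.const_smul r).mul continuous_snd)
          ((continuous_fst.mul continuous_snd).const_smul r)
      | ih x y => rw [← coe_smul, ← coe_mul, ← coe_mul, ← coe_smul, smul_mul_assoc])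
    (fun r x y ↦ by
      induction x, y using Completion.induction_on₂ with
      | hp =>
        exact isClosed_eq (continuous_fst.mul (continuous_snd.const_smul r))
          ((continuous_fst.mul continuous_snd).const_smul r)
      | ih x y => rw [← coe_smul, ← coe_mul, ← coe_mul, ← coe_smul, mul_smul_comm])
  norm_smul_le r x := norm_smul_le r x

variable [StarRing B] [NormedStarGroup B] [StarModule ℂ B]

instance : StarModule ℂ (Completion B) where
  star_smul r x := by
    induction x using Completion.induction_on with
    | hp =>
      exact isClosed_eq (continuous_id.const_smul r).star (continuous_star.const_smul (star r))
    | ih x => rw [← coe_smul, star_coe, star_coe, ← coe_smul, star_smul]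

/-- The completion of a seminormed star algebra satisfying the C⋆-inequality. -/
noncomputable abbrev cstarAlgebra (h : ∀ x : B, ‖x‖ * ‖x‖ ≤ ‖star x * x‖) :
    CStarAlgebra (Completion B) where
  norm_smul_le := norm_smul_le
  star_smul := star_smul
  norm_mul_self_le x := by
    induction x using Completion.induction_on with
    | hp => exact isClosed_le (by fun_prop) (by fun_prop)
    | ih x =>
      rw [star_coe, ← coe_mul, norm_coe, norm_coe]
      exact h x

end UniformSpace.Completion

/-- The completion of a complex star algebra with respect to a C⋆-seminorm is a C⋆-algebra. -/
theorem RingSeminorm.exists_cstarAlgebra_starAlgHom {B : Type u} [Ring B] [Algebra ℂ B]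
    [StarRing B] [StarModule ℂ B] (N : RingSeminorm B)
    (smul_le : ∀ (r : ℂ) (x : B), N (r • x) ≤ ‖r‖ * N x)
    (star_le : ∀ x : B, N (star x) ≤ N x)
    (mul_self_le : ∀ x : B, N x * N x ≤ N (star x * x)) :
    ∃ (E : Type u) (_ : CStarAlgebra E) (φ : B →⋆ₐ[ℂ] E), ∀ x, ‖φ x‖ = N x := by
  -- The completion is Hausdorff, so it also divides out the null space of `N`.
  let _ : SeminormedRing B := N.toSeminormedRing
  let _ : NormedAlgebra ℂ B := { ‹Algebra ℂ B› with norm_smul_le := smul_le }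
  have : NormedStarGroup B := ⟨star_le⟩
  let φ : B →ₐ[ℂ] Completion B := AlgHom.ofLinearMap
    { toFun := fun x ↦ x
      map_add' := Completion.coe_add
      map_smul' := Completion.coe_smul } (Completion.coe_one B) Completion.coe_mul
  exact ⟨Completion B, Completion.cstarAlgebra mul_self_le,
    { φ with map_star' := fun x ↦ (Completion.star_coe x).symm }, Completion.norm_coe⟩

end Completion

/-! ### C⋆-ultraproducts -/

section Ultraproduct

variable {ι : Type} {A : ι → Type u} [∀ i, CStarAlgebra (A i)]

open scoped ENNReal

theorem Ultrafilter.exists_tendsto_norm_lp (U : Ultrafilter ι) (x : lp A ∞) :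
    ∃ r : ℝ, Tendsto (fun i ↦ ‖x i‖) U (𝓝 r) := by
  have h : ∀ i, ‖x i‖ ∈ Set.Icc 0 ‖x‖ := fun i ↦
    ⟨norm_nonneg _, lp.norm_apply_le_norm ENNReal.top_ne_zero x i⟩
  obtain ⟨r, -, hr⟩ := (isCompact_Icc (a := (0 : ℝ)) (b := ‖x‖)).ultrafilter_le_nhds'
    (U.map fun i ↦ ‖x i‖) (Filter.mem_map.2 (Filter.Eventually.of_forall h))
  exact ⟨r, hr⟩

/-- The limit of the norms of the coordinates along an ultrafilter. -/
noncomputable def Ultrafilter.normLim (U : Ultrafilter ι) (x : lp A ∞) : ℝ :=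
  (U.exists_tendsto_norm_lp x).choose

theorem Ultrafilter.tendsto_normLim (U : Ultrafilter ι) (x : lp A ∞) :
    Tendsto (fun i ↦ ‖x i‖) U (𝓝 (U.normLim x)) :=
  (U.exists_tendsto_norm_lp x).choose_spec

variable [∀ i, Nontrivial (A i)]

/-- The limit of the norms along an ultrafilter, as a ring seminorm. -/
noncomputable def Ultrafilter.ringSeminorm (U : Ultrafilter ι) : RingSeminorm (lp A ∞) where
  toFun := U.normLim
  map_zero' := tendsto_nhds_unique (U.tendsto_normLim _) (by simp)
  add_le' x y := le_of_tendsto_of_tendsto' (U.tendsto_normLim _)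
    ((U.tendsto_normLim x).add (U.tendsto_normLim y)) fun i ↦ norm_add_le _ _
  neg' x := tendsto_nhds_unique (U.tendsto_normLim _) (by simpa using U.tendsto_normLim x)
  mul_le' x y := le_of_tendsto_of_tendsto' (U.tendsto_normLim _)
    ((U.tendsto_normLim x).mul (U.tendsto_normLim y)) fun i ↦ norm_mul_le _ _

/-- The C⋆-algebraic ultraproduct: a C⋆-algebra receiving all bounded families, in which the norm
is the limit of the norms. -/
theorem Ultrafilter.exists_ultraproduct (U : Ultrafilter ι) :
    ∃ (E : Type u) (_ : CStarAlgebra E) (φ : lp A ∞ →⋆ₐ[ℂ] E),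
      ∀ x : lp A ∞, Tendsto (fun i ↦ ‖x i‖) U (𝓝 ‖φ x‖) := by
  obtain ⟨E, hE, φ, hφ⟩ := (U.ringSeminorm (A := A)).exists_cstarAlgebra_starAlgHom
    (fun r x ↦ le_of_tendsto_of_tendsto' (U.tendsto_normLim _)
      ((U.tendsto_normLim x).const_mul ‖r‖) fun i ↦ norm_smul_le _ _)
    (fun x ↦ le_of_tendsto_of_tendsto' (U.tendsto_normLim _) (U.tendsto_normLim x)
      fun i ↦ (norm_star (x i)).le)
    (fun x ↦ le_of_tendsto_of_tendsto' ((U.tendsto_normLim x).mul (U.tendsto_normLim x))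
      (U.tendsto_normLim _) fun i ↦ CStarRing.norm_mul_self_le (x i))
  exact ⟨E, hE, φ, fun x ↦ (hφ x).symm ▸ U.tendsto_normLim x⟩

end Ultraproduct

/-! ### Functional calculus and spectra -/

section Calculus

variable {A : Type u} [CStarAlgebra A]

theorem starEval_eq_cfc (p : MvPolynomial (Fin 2) ℂ) (a : A) [IsStarNormal a] :
    starEval p a = cfc (scalarEval p) a := by
  have h : scalarEval p =
      fun z ↦ ∑ d ∈ p.support, p.coeff d • (z ^ d 0 * star z ^ d 1) := by
    ext z
    simp [scalarEval, MvPolynomial.eval_eq']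
  rw [h, ← Finset.sum_fn, cfc_sum _ _ _ (fun i _ ↦ by fun_prop)]
  refine Finset.sum_congr rfl fun d _ ↦ ?_
  rw [cfc_smul _ _ _ (by fun_prop), cfc_mul _ _ _ (by fun_prop) (by fun_prop), cfc_pow_id a,
    cfc_pow _ _ a (by fun_prop), cfc_star_id a]

theorem norm_starEval_le_sum {a : A} (ha : ‖a‖ ≤ 1) (p : MvPolynomial (Fin 2) ℂ) :
    ‖starEval p a‖ ≤ ∑ d ∈ p.support, ‖p.coeff d‖ := by
  cases subsingleton_or_nontrivial A
  · rw [Subsingleton.elim (starEval p a) 0, norm_zero]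
    exact Finset.sum_nonneg fun d _ ↦ norm_nonneg _
  refine (norm_sum_le _ _).trans (Finset.sum_le_sum fun d _ ↦ ?_)
  rw [norm_smul]
  refine mul_le_of_le_one_right (norm_nonneg _) ((norm_mul_le _ _).trans ?_)
  refine mul_le_one₀ ((norm_pow_le _ _).trans (pow_le_one₀ (norm_nonneg _) ha)) (norm_nonneg _)
    ((norm_pow_le _ _).trans (pow_le_one₀ (norm_nonneg _) ?_))
  rwa [norm_star]

/-- The spectrum of the inverse contains `(z - c)⁻¹`, whose modulus is at most the norm `r⁻¹`
allows. -/
theorem InvNormLE.le_norm_sub_of_mem_spectrum {a : A} {c z : ℂ} {r : ℝ} (hr : 0 < r)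
    (h : InvNormLE (a - algebraMap ℂ A c) r⁻¹) (hz : z ∈ spectrum ℂ a) : r ≤ ‖z - c‖ := by
  obtain ⟨v, hv, hle⟩ := h
  have : Nontrivial A := by
    by_contra hA
    rw [not_nontrivial_iff_subsingleton] at hA
    simp at hz
  have hmem : z - c ∈ spectrum ℂ (v : A) := by
    rw [hv]
    simpa [sub_eq_add_neg, add_comm] using (spectrum.add_mem_add_iff (s := -c)).2 hz
  have hne : z - c ≠ 0 := spectrum.ne_zero_of_mem_of_unit hmem
  have hinv : (z - c)⁻¹ ∈ spectrum ℂ ((v⁻¹ : Aˣ) : A) := by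
    simpa using (spectrum.inv_mem_iff (r := Units.mk0 _ hne)).1 hmem
  have := (spectrum.norm_le_norm_of_mem hinv).trans hle
  rw [norm_inv] at this
  exact (inv_le_inv₀ (norm_pos_iff.2 hne) hr).1 this

theorem spectrum_subset_holedDisk {n : ℕ} {c : Fin n → ℂ} {R : Fin n → ℝ} (hR : ∀ j, 0 < R j)
    {a : A} (ha : ‖a‖ ≤ 1) (hinv : ∀ j, InvNormLE (a - algebraMap ℂ A (c j)) (R j)⁻¹) :
    spectrum ℂ a ⊆ holedDisk c R := fun z hz ↦ by
  refine ⟨?_, fun j ↦ (hinv j).le_norm_sub_of_mem_spectrum (hR j) hz⟩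
  have : Nontrivial A := by
    by_contra hA
    rw [not_nontrivial_iff_subsingleton] at hA
    simp at hz
  exact (spectrum.norm_le_norm_of_mem hz).trans ha

end Calculus

theorem isCompact_holedDisk {n : ℕ} (c : Fin n → ℂ) (R : Fin n → ℝ) :
    IsCompact (holedDisk c R) := by
  refine (isCompact_closedBall (0 : ℂ) 1).of_isClosed_subset ?_ fun z hz ↦ by simpa using hz.1
  have h : holedDisk c R = {z | ‖z‖ ≤ 1} ∩ ⋂ j, {z | R j ≤ ‖z - c j‖} := by
    ext z
    simp [holedDisk]
  rw [h]
  exact (isClosed_le (by fun_prop) (by fun_prop)).inter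
    (isClosed_iInter fun j ↦ isClosed_le (by fun_prop) (by fun_prop))

theorem continuous_scalarEval (p : MvPolynomial (Fin 2) ℂ) : Continuous (scalarEval p) := by
  unfold scalarEval
  simp only [MvPolynomial.eval_eq', Fin.prod_univ_two]
  simp only [Matrix.cons_val_zero, Matrix.cons_val_one]
  fun_prop

/-! ### Passage to the ultraproduct -/

section Limit

open scoped ENNReal

variable {ι : Type} {A : ι → Type u} [∀ i, CStarAlgebra (A i)]

theorem starEval_lp_apply [∀ i, Nontrivial (A i)] (p : MvPolynomial (Fin 2) ℂ) (x : lp A ∞)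
    (i : ι) : (∑ d ∈ p.support, p.coeff d • (x ^ d 0 * star x ^ d 1) : lp A ∞) i =
      starEval p (x i) := by
  refine (congrFun (lp.coeFn_sum _ _) i).trans ?_
  rw [Finset.sum_apply]
  rfl

/-- If the norms of the commutators `[aᵢ, aᵢ⋆]` tend to zero along an ultrafilter, the norms of
`p(aᵢ, aᵢ⋆)` cannot stay above a bound for `‖p‖` on the holed disk. -/
theorem exists_norm_starEval_le_of_tendsto (U : Ultrafilter ι) {n : ℕ} {c : Fin n → ℂ}
    {R : Fin n → ℝ} (hR : ∀ j, 0 < R j) {p : MvPolynomial (Fin 2) ℂ} {M M' : ℝ} (hM0 : 0 ≤ M)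
    (hMM' : M < M') (hM : ∀ z ∈ holedDisk c R, ‖scalarEval p z‖ ≤ M) (a : ∀ i, A i)
    (ha : ∀ i, ‖a i‖ ≤ 1) (hinv : ∀ i j, InvNormLE (a i - algebraMap ℂ (A i) (c j)) (R j)⁻¹)
    (hcomm : Tendsto (fun i ↦ ‖a i * star (a i) - star (a i) * a i‖) U (𝓝 0)) :
    ∃ i, ‖starEval p (a i)‖ ≤ M' := by
  by_contra! hlt
  -- In a zero algebra `p` evaluates to `0 < M'`. Nontriviality gives `‖1‖ = 1`, used for the unital
  -- ring of bounded families.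
  have (i : ι) : Nontrivial (A i) := by
    by_contra hA
    rw [not_nontrivial_iff_subsingleton] at hA
    have := hlt i
    rw [Subsingleton.elim (starEval p (a i)) 0, norm_zero] at this
    linarith
  obtain ⟨E, _, φ, hφ⟩ := U.exists_ultraproduct (A := A)
  choose v hv hvle using hinv
  let x : lp A ∞ := ⟨a, memℓp_infty ⟨1, by rintro _ ⟨i, rfl⟩; exact ha i⟩⟩
  -- The uniform bound `(R j)⁻¹` makes the coordinatewise inverses a bounded family.
  let y (j : Fin n) : lp A ∞ := ⟨fun i ↦ ((v i j)⁻¹ : (A i)ˣ),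
    memℓp_infty ⟨(R j)⁻¹, by rintro _ ⟨i, rfl⟩; exact hvle i j⟩⟩
  have hxn : ‖φ x‖ ≤ 1 := le_of_tendsto' (hφ x) ha
  have hxinv (j : Fin n) : InvNormLE (φ x - algebraMap ℂ E (c j)) (R j)⁻¹ := by
    have hl : (x - algebraMap ℂ (lp A ∞) (c j)) * y j = 1 := by
      ext i
      have : (a i - algebraMap ℂ (A i) (c j)) * ((v i j)⁻¹ : (A i)ˣ) = 1 := by simp [← hv]
      exact this
    have hr : y j * (x - algebraMap ℂ (lp A ∞) (c j)) = 1 := by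
      ext i
      have : ((v i j)⁻¹ : (A i)ˣ) * (a i - algebraMap ℂ (A i) (c j)) = 1 := by simp [← hv]
      exact this
    refine ⟨⟨φ (x - algebraMap ℂ (lp A ∞) (c j)), φ (y j), ?_, ?_⟩, ?_,
      le_of_tendsto' (hφ (y j)) fun i ↦ hvle i j⟩
    · rw [← map_mul, hl, map_one]
    · rw [← map_mul, hr, map_one]
    · simp [map_sub, AlgHomClass.commutes]
  have hnormal : IsStarNormal (φ x) := by
    have h0 : ‖φ (x * star x - star x * x)‖ = 0 := tendsto_nhds_unique (hφ _) hcomm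
    rw [norm_eq_zero, map_sub, map_mul, map_mul, map_star, sub_eq_zero] at h0
    exact ⟨h0.symm⟩
  have hle : ‖starEval p (φ x)‖ ≤ M := by
    rw [starEval_eq_cfc]
    exact norm_cfc_le hM0 fun z hz ↦ hM z (spectrum_subset_holedDisk hR hxn hxinv hz)
  have hge : M' ≤ ‖starEval p (φ x)‖ := by
    have := hφ (∑ d ∈ p.support, p.coeff d • (x ^ d 0 * star x ^ d 1))
    simp only [starEval_lp_apply, map_sum, map_smul, map_mul, map_pow, map_star] at this
    exact ge_of_tendsto' this fun i ↦ (hlt i).le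
  linarith

end Limit

/-! ### Uniform threshold and final constant -/

theorem exists_pos_norm_starEval_le {n : ℕ} {c : Fin n → ℂ} {R : Fin n → ℝ} (hR : ∀ j, 0 < R j)
    {p : MvPolynomial (Fin 2) ℂ} {M M' : ℝ} (hM0 : 0 ≤ M) (hMM' : M < M')
    (hM : ∀ z ∈ holedDisk c R, ‖scalarEval p z‖ ≤ M) :
    ∃ δ₀ : ℝ, 0 < δ₀ ∧ ∀ (A : Type u) [CStarAlgebra A] (a : A),
      ‖a‖ ≤ 1 → ‖a * star a - star a * a‖ ≤ δ₀ →
      (∀ j, InvNormLE (a - algebraMap ℂ A (c j)) (R j)⁻¹) → ‖starEval p a‖ ≤ M' := by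
  by_contra! h
  choose A hA a ha hcomm hinv hlt using fun k : ℕ ↦ h (1 / (k + 1)) Nat.one_div_pos_of_nat
  obtain ⟨k, hk⟩ := exists_norm_starEval_le_of_tendsto (hyperfilter ℕ) hR hM0 hMM' hM a ha hinv
    (squeeze_zero (fun k ↦ norm_nonneg _) hcomm
      (tendsto_one_div_add_atTop_nhds_zero_nat.mono_left Nat.hyperfilter_le_atTop))
  exact (hlt k).not_ge hk

theorem theorem2 (n : ℕ) (c : Fin n → ℂ) (R : Fin n → ℝ) (hR : ∀ j, 0 < R j)
    (hS : (holedDisk c R).Nonempty) (p : MvPolynomial (Fin 2) ℂ) :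
    ∃ M : ℝ, IsGreatest ((fun z : ℂ => ‖scalarEval p z‖) '' holedDisk c R) M ∧
      ∀ ε : ℝ, 0 < ε → ∃ C : ℝ, ∀ (A : Type u) [CStarAlgebra A] (a : A) (δ : ℝ),
        ‖a‖ ≤ 1 → ‖a * star a - star a * a‖ ≤ δ →
        (∀ j, InvNormLE (a - algebraMap ℂ A (c j)) (R j)⁻¹) →
        ‖starEval p a‖ ≤ M + ε + C * δ := by
  obtain ⟨M, hM⟩ := ((isCompact_holedDisk c R).image
    (continuous_scalarEval p).norm).exists_isGreatest (hS.image _)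
  refine ⟨M, hM, fun ε hε ↦ ?_⟩
  have hM0 : 0 ≤ M := by
    obtain ⟨z, -, hz⟩ := hM.1
    exact hz ▸ norm_nonneg _
  obtain ⟨δ₀, hδ₀, hbound⟩ := exists_pos_norm_starEval_le.{u} hR hM0 (lt_add_of_pos_right M hε)
    fun z hz ↦ hM.2 ⟨z, hz, rfl⟩
  have hsum : 0 ≤ ∑ d ∈ p.support, ‖p.coeff d‖ := Finset.sum_nonneg fun d _ ↦ norm_nonneg _
  -- With this constant, `C * δ` alone exceeds the crude bound as soon as `δ > δ₀`, up to equality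
  -- when `p = 0`.
  refine ⟨(∑ d ∈ p.support, ‖p.coeff d‖) / δ₀, fun A _ a δ ha hδ hinv ↦ ?_⟩
  have hδ0 : 0 ≤ δ := (norm_nonneg _).trans hδ
  obtain hle | hlt := le_or_gt δ δ₀
  · have := hbound A a ha (hδ.trans hle) hinv
    have : 0 ≤ (∑ d ∈ p.support, ‖p.coeff d‖) / δ₀ * δ := by positivity
    linarith
  · have h1 := norm_starEval_le_sum ha p
    have : ∑ d ∈ p.support, ‖p.coeff d‖ ≤ (∑ d ∈ p.support, ‖p.coeff d‖) / δ₀ * δ := by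
      rw [div_mul_eq_mul_div, le_div_iff₀ hδ₀]
      exact mul_le_mul_of_nonneg_left hlt.le hsum
    linarith
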